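/- Let $n\ge 2$, $r>0$, let $\overline B_r\subset\mathbb R^n$ be a closed Euclidean ball of radius $r$ (with arbitrary center), and let $M^n\subset\mathbb R^{n+1}$ be the graph $\{(x,f(x)) : x\in\overline B_r\}$ of a function $f:\overline B_r\to\mathbb R$ that is of class $C^2$ on $\overline B_r$ (up to the boundary). Let $k_1,\dots,k_n$ be the principal curvatures of $M$ with respect to a unit normal field, $H=\frac1n\sum_{i}k_i$ the mean curvature, and $R=\frac{2}{n(n-1)}\sum_{i<j}k_ik_j$ the (normalized) scalar curvature, that is, the trace of the Ricci tensor of $M$ divided by $n(n-1)$, the curvature tensor being given by the Gauss equation. Then $\sup_M|H|<\infty$ and $$\inf_M|R|\le\Big(\sup_M|H|+\frac1r\Big)\frac2r .$$ Moreover, if $M$ has a point at which the second fundamental form is (positive or negative) semi-definite, then $$\inf_M|R|<\frac1{r^2}.$$ The last estimate is sharp: for every $n\ge2$, every closed ball $\overline B_r\subset\mathbb R^n$ of radius $r>0$ and every $C<1/r^2$ there is a graph $M$ over $\overline B_r$ of a $C^2$ function, having a point where the second fundamental form is semi-definite, such that $\inf_M|R|>C$. -/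

import Mathlib

open Set Metric
open scoped Matrix

noncomputable section

namespace GraphGeometry

variable {n : ℕ}

/-- The Euclidean space `ℝⁿ`, in which the domain of the graph lies. -/
abbrev Base (n : ℕ) : Type := EuclideanSpace ℝ (Fin n)

/-- The Euclidean space `ℝⁿ⁺¹`, in which the graph lies. -/
abbrev Ambient (n : ℕ) : Type := EuclideanSpace ℝ (Fin (n + 1))

/-- The point `(x, t)` of `ℝⁿ⁺¹ = ℝⁿ × ℝ`, whose last coordinate is `t`. -/
def pair (x : Base n) (t : ℝ) : Ambient n :=
  WithLp.toLp 2 (Fin.snoc (α := fun _ => ℝ) (fun i => x i) t)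

/-- The parametrization `x ↦ (x, f x)` of the graph of `f`. -/
def graphMap (f : Base n → ℝ) (x : Base n) : Ambient n :=
  pair x (f x)

/-- The differential of the graph parametrization at `x`; derivatives are taken within the domain
`s`, so that they are one-sided at boundary points. -/
def tangentMap (f : Base n → ℝ) (s : Set (Base n)) (x : Base n) : Base n →L[ℝ] Ambient n :=
  fderivWithin ℝ (graphMap f) s x

/-- The second derivative of the graph parametrization at `x`. -/
def secondDeriv (f : Base n → ℝ) (s : Set (Base n)) (x : Base n) :
    Base n →L[ℝ] Base n →L[ℝ] Ambient n :=
  fderivWithin ℝ (tangentMap f s) s x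

/-- The upward unit normal `(-∇f, 1) / √(1 + |∇f|²)` of the graph. -/
def unitNormal (f : Base n → ℝ) (s : Set (Base n)) (x : Base n) : Ambient n :=
  (Real.sqrt (1 + ‖gradientWithin f s x‖ ^ 2))⁻¹ • pair (-gradientWithin f s x) 1

/-- The first fundamental form (induced metric), pulled back to the domain. -/
def firstForm (f : Base n → ℝ) (s : Set (Base n)) (x v w : Base n) : ℝ :=
  inner ℝ (tangentMap f s x v) (tangentMap f s x w)

/-- The second fundamental form, pulled back to the domain. -/
def secondForm (f : Base n → ℝ) (s : Set (Base n)) (x v w : Base n) : ℝ :=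
  inner ℝ (secondDeriv f s x v w) (unitNormal f s x)

/-- The second fundamental form is positive or negative semi-definite at the point over `x`. -/
def SecondFormSemidefinite (f : Base n → ℝ) (s : Set (Base n)) (x : Base n) : Prop :=
  (∀ v, 0 ≤ secondForm f s x v v) ∨ (∀ v, secondForm f s x v v ≤ 0)

/-- The coefficients `g i j` of the first fundamental form in the coordinate frame. -/
def gMatrix (f : Base n → ℝ) (s : Set (Base n)) (x : Base n) : Matrix (Fin n) (Fin n) ℝ :=
  Matrix.of fun i j =>
    firstForm f s x (EuclideanSpace.single i 1) (EuclideanSpace.single j 1)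

/-- The coefficients `h i j` of the second fundamental form in the coordinate frame. -/
def hMatrix (f : Base n → ℝ) (s : Set (Base n)) (x : Base n) : Matrix (Fin n) (Fin n) ℝ :=
  Matrix.of fun i j =>
    secondForm f s x (EuclideanSpace.single i 1) (EuclideanSpace.single j 1)

/-- The matrix `g⁻¹ h` of the shape operator in the coordinate frame. -/
def shapeMatrix (f : Base n → ℝ) (s : Set (Base n)) (x : Base n) : Matrix (Fin n) (Fin n) ℝ :=
  (gMatrix f s x)⁻¹ * hMatrix f s x

/-- The mean curvature: the average of the principal curvatures, `H = tr A / n`. -/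
def meanCurvature (f : Base n → ℝ) (s : Set (Base n)) (x : Base n) : ℝ :=
  (shapeMatrix f s x).trace / n

/-- The curvature tensor `⟨Rm(∂ᵢ, ∂ⱼ) ∂ₖ, ∂ₗ⟩` of the induced metric. The graph is only of class
`C²`, so its metric is only of class `C¹`, and the tensor is the one given by the Gauss equation
in the flat ambient space. -/
def riemannCurvature (f : Base n → ℝ) (s : Set (Base n)) (x : Base n) (i j k l : Fin n) : ℝ :=
  hMatrix f s x i l * hMatrix f s x j k - hMatrix f s x i k * hMatrix f s x j l

/-- The (unnormalized) Ricci tensor: the metric trace of the curvature tensor. -/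
def ricciCurvature (f : Base n → ℝ) (s : Set (Base n)) (x : Base n) (j k : Fin n) : ℝ :=
  ∑ i, ∑ l, (gMatrix f s x)⁻¹ i l * riemannCurvature f s x i j k l

/-- The normalized scalar curvature: the metric trace of the Ricci tensor divided by `n (n - 1)`,
which is the average of the products `kᵢ kⱼ`, `i < j`, of the principal curvatures. -/
def scalarCurvature (f : Base n → ℝ) (s : Set (Base n)) (x : Base n) : ℝ :=
  (∑ j, ∑ k, (gMatrix f s x)⁻¹ j k * ricciCurvature f s x j k) / ((n : ℝ) * ((n : ℝ) - 1))

end GraphGeometry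

end

/-!
The graph is compared with hemispheres whose radius `ρ` is slightly larger than `r`.

Let `u(x) = -√(ρ² - |x - c|²)` be a lower hemisphere. On the boundary sphere its outward slope is
`r / √(ρ² - r²)`, which exceeds the maximal slope of `f` as soon as `ρ` is close enough to `r`, so
`f - u` attains its maximum over the closed ball at an interior point `p`. There `∇f = ∇u` and
`D²f ≤ D²u`; since the second fundamental form of the hemisphere is `1 / ρ` times its metric, all
principal curvatures of the graph of `f` at `p` are at most `k = 1 / ρ < 1 / r`
(`GraphGeometry.exists_secondForm_le`). The same argument for `-f` yields a point where they are at
least `-k` (`GraphGeometry.exists_le_secondForm`).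

The rest is algebra of the principal curvatures, done with a symmetric matrix `A` that represents
the shape operator in an orthonormal frame (`GraphGeometry.exists_shape`), so that `H = tr A / n`
and `R = ((tr A)² - tr A²) / (n (n - 1))`:

* `R ≤ H²` everywhere, and `R ≥ 0` where the second fundamental form is semi-definite;
* `R ≥ 2 k H - k²` wherever all principal curvatures are at most `k`, because
  `∑_{i ≠ j} (k - kᵢ) (k - kⱼ) ≥ 0`.

Suppose first that `R ≥ 0` at some point. Either `R` has a zero and `inf |R| = 0`, or `R > 0` on the
whole ball; then `H` has no zero by the first item, so it has a constant sign, and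
`R ≤ H² ≤ k² < 1 / r²` at one of the two points of contact. In the remaining case `R < 0`, the second
item gives `|R| ≤ k² + 2 k |H|` at a point of contact, which is enough for the first estimate; a
semi-definite point excludes this case. The hemispheres themselves, for which `R = 1 / ρ²`, show that
the second estimate is sharp.
-/

/-! ### Fundamental forms of a graph -/

namespace GraphGeometry

variable {n : ℕ}

/-- The identification `(x, t) ↦ pair x t` of `ℝⁿ × ℝ` with `ℝⁿ⁺¹` as a continuous linear map. -/
noncomputable def pairCLM (n : ℕ) : Base n × ℝ →L[ℝ] Ambient n :=
  LinearMap.toContinuousLinearMap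
    { toFun := fun p => pair p.1 p.2
      map_add' := fun p q => by
        ext i
        refine Fin.lastCases ?_ (fun i => ?_) i <;> simp [pair]
      map_smul' := fun a p => by
        ext i
        refine Fin.lastCases ?_ (fun i => ?_) i <;> simp [pair] }

lemma inner_pair_pair (v w : Base n) (a b : ℝ) :
    inner ℝ (pair v a) (pair w b) = inner ℝ v w + a * b := by
  simp [pair, PiLp.inner_apply, Fin.sum_univ_castSucc, mul_comm]

section Formulas

variable {f : Base n → ℝ} {s : Set (Base n)} {x : Base n}

lemma hasFDerivWithinAt_fderivWithin (hs : UniqueDiffOn ℝ s) (hf : ContDiffOn ℝ 2 f s)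
    (hx : x ∈ s) :
    HasFDerivWithinAt (fderivWithin ℝ f s) (fderivWithin ℝ (fderivWithin ℝ f s) s x) s x :=
  (((hf.fderivWithin hs (m := 1) (by norm_num)).differentiableOn
    (by norm_num)) x hx).hasFDerivWithinAt

lemma tangentMap_eq (hs : UniqueDiffOn ℝ s) (hf : ContDiffOn ℝ 2 f s) (hx : x ∈ s) :
    tangentMap f s x =
      (pairCLM n).comp ((ContinuousLinearMap.id ℝ (Base n)).prod (fderivWithin ℝ f s x)) := by
  have h1 : HasFDerivWithinAt f (fderivWithin ℝ f s x) s x :=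
    (hf.differentiableOn (by norm_num) x hx).hasFDerivWithinAt
  have h2 := (pairCLM n).hasFDerivAt.comp_hasFDerivWithinAt x ((hasFDerivWithinAt_id x s).prodMk h1)
  exact h2.fderivWithin (hs x hx)

lemma tangentMap_apply (hs : UniqueDiffOn ℝ s) (hf : ContDiffOn ℝ 2 f s) (hx : x ∈ s)
    (v : Base n) : tangentMap f s x v = pair v (fderivWithin ℝ f s x v) := by
  rw [tangentMap_eq hs hf hx]; rfl

lemma secondDeriv_apply (hs : UniqueDiffOn ℝ s) (hf : ContDiffOn ℝ 2 f s) (hx : x ∈ s)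
    (v w : Base n) :
    secondDeriv f s x v w = pair 0 (fderivWithin ℝ (fderivWithin ℝ f s) s x v w) := by
  have h1 := hasFDerivWithinAt_fderivWithin hs hf hx
  have h3 : HasFDerivWithinAt (fun y => (pairCLM n).comp
      ((ContinuousLinearMap.id ℝ (Base n)).prod (fderivWithin ℝ f s y)))
      ((ContinuousLinearMap.compL ℝ (Base n) ℝ (Ambient n)
        ((pairCLM n).comp (ContinuousLinearMap.inr ℝ (Base n) ℝ))).comp
          (fderivWithin ℝ (fderivWithin ℝ f s) s x)) s x := by
    have h4 := ((ContinuousLinearMap.compL ℝ (Base n) ℝ (Ambient n)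
        ((pairCLM n).comp (ContinuousLinearMap.inr ℝ (Base n) ℝ))).hasFDerivAt.comp_hasFDerivWithinAt
          x h1).const_add ((pairCLM n).comp (ContinuousLinearMap.inl ℝ (Base n) ℝ))
    refine h4.congr_of_eventuallyEq (Filter.Eventually.of_forall fun y => ?_) ?_ <;>
    · ext1 v
      simp [← map_add]
  have h5 : HasFDerivWithinAt (tangentMap f s) _ s x :=
    h3.congr (fun y hy => tangentMap_eq hs hf hy) (tangentMap_eq hs hf hx)
  rw [secondDeriv, h5.fderivWithin (hs x hx)]
  rfl

lemma firstForm_eq (hs : UniqueDiffOn ℝ s) (hf : ContDiffOn ℝ 2 f s) (hx : x ∈ s)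
    (v w : Base n) :
    firstForm f s x v w = inner ℝ v w + fderivWithin ℝ f s x v * fderivWithin ℝ f s x w := by
  rw [firstForm, tangentMap_apply hs hf hx, tangentMap_apply hs hf hx, inner_pair_pair]

lemma norm_gradientWithin (f : Base n → ℝ) (s : Set (Base n)) (x : Base n) :
    ‖gradientWithin f s x‖ = ‖fderivWithin ℝ f s x‖ := by
  simp [gradientWithin]

lemma secondForm_eq (hs : UniqueDiffOn ℝ s) (hf : ContDiffOn ℝ 2 f s) (hx : x ∈ s)
    (v w : Base n) :
    secondForm f s x v w = (Real.sqrt (1 + ‖fderivWithin ℝ f s x‖ ^ 2))⁻¹ *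
      fderivWithin ℝ (fderivWithin ℝ f s) s x v w := by
  rw [secondForm, secondDeriv_apply hs hf hx, unitNormal, inner_smul_right, inner_pair_pair,
    norm_gradientWithin]
  simp

end Formulas
end GraphGeometry

/-! ### Symmetric matrices -/

section Matrices

variable {ι : Type*}

lemma Matrix.PosSemidef.sq_apply_le {M : Matrix ι ι ℝ} (hM : M.PosSemidef) (i j : ι) :
    M i j ^ 2 ≤ M i i * M j j := by
  have h := (hM.submatrix ![i, j]).det_nonneg
  have hs : M j i = M i j := by simpa using hM.1.apply i j
  rw [Matrix.det_fin_two] at h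
  simp only [Matrix.submatrix_apply, Matrix.cons_val_zero, Matrix.cons_val_one, hs] at h
  nlinarith

variable [Fintype ι]

lemma Matrix.PosSemidef.trace_mul_self_le {M : Matrix ι ι ℝ} (hM : M.PosSemidef) :
    (M * M).trace ≤ M.trace ^ 2 := by
  simp only [Matrix.trace, Matrix.diag_apply, Matrix.mul_apply, sq, Finset.sum_mul_sum]
  refine Finset.sum_le_sum fun i _ => Finset.sum_le_sum fun j _ => ?_
  have hs : M j i = M i j := by simpa using hM.1.apply i j
  rw [hs, ← sq]
  exact hM.sq_apply_le i j

lemma Matrix.IsSymm.sq_trace_le {M : Matrix ι ι ℝ} (hM : M.IsSymm) :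
    M.trace ^ 2 ≤ Fintype.card ι * (M * M).trace := by
  have h1 : M.trace ^ 2 ≤ Fintype.card ι * ∑ i, M i i ^ 2 := by
    simpa [Matrix.trace] using sq_sum_le_card_mul_sum_sq (s := Finset.univ) (f := fun i => M i i)
  refine h1.trans (mul_le_mul_of_nonneg_left ?_ (Nat.cast_nonneg _))
  simp only [Matrix.trace, Matrix.diag_apply, Matrix.mul_apply]
  refine Finset.sum_le_sum fun i _ => ?_
  have := Finset.single_le_sum (f := fun j => M i j * M j i) (s := Finset.univ)
    (fun j _ => by rw [hM.apply i j]; exact mul_self_nonneg _) (Finset.mem_univ i)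
  simpa [sq] using this

open scoped MatrixOrder in
/-- A positive semidefinite real matrix is a product `Bᵀ * B`. -/
lemma Matrix.PosSemidef.exists_eq_transpose_mul_self {M : Matrix ι ι ℝ}
    (hM : M.PosSemidef) : ∃ B : Matrix ι ι ℝ, M = Bᵀ * B := by
  classical
  refine ⟨CFC.sqrt M, ?_⟩
  have h1 : (CFC.sqrt M)ᵀ = CFC.sqrt M := by
    simpa [IsHermitian, conjTranspose_eq_transpose_of_trivial] using
      (Matrix.nonneg_iff_posSemidef.1 (CFC.sqrt_nonneg M)).1
  rw [h1, CFC.sqrt_mul_sqrt_self M (Matrix.nonneg_iff_posSemidef.2 hM)]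

lemma Matrix.IsSymm.trace_mul_eq_sum {h : Matrix ι ι ℝ} (hh : h.IsSymm) (G : Matrix ι ι ℝ) :
    (G * h).trace = ∑ i, ∑ l, G i l * h i l := by
  simp only [Matrix.trace, Matrix.diag_apply, Matrix.mul_apply]
  exact Finset.sum_congr rfl fun i _ => Finset.sum_congr rfl fun l _ => by rw [hh.apply i l]

/-- The double contraction of the Gauss curvature tensor built from `h` by the inverse metric `G`:
twice the second elementary symmetric function of the eigenvalues of `G * h`. -/
lemma Matrix.IsSymm.sum_contraction_eq {h : Matrix ι ι ℝ} (hh : h.IsSymm) (G : Matrix ι ι ℝ) :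
    ∑ j, ∑ k, G j k * ∑ i, ∑ l, G i l * (h i l * h j k - h i k * h j l) =
      (G * h).trace ^ 2 - ((G * h) * (G * h)).trace := by
  have h1 : ∑ j, ∑ k, G j k * ∑ i, ∑ l, G i l * (h i l * h j k) = (G * h).trace ^ 2 := by
    rw [hh.trace_mul_eq_sum, sq, Finset.sum_mul]
    refine Finset.sum_congr rfl fun j _ => ?_
    rw [Finset.sum_mul]
    refine Finset.sum_congr rfl fun k _ => ?_
    rw [mul_assoc]
    simp only [Finset.mul_sum]
    exact Finset.sum_congr rfl fun i _ => Finset.sum_congr rfl fun l _ => by ring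
  have h2 : ∑ j, ∑ k, G j k * ∑ i, ∑ l, G i l * (h i k * h j l) =
      ((G * h) * (G * h)).trace := by
    simp only [Matrix.trace, Matrix.diag_apply, Matrix.mul_apply, Finset.mul_sum, Finset.sum_mul]
    refine Finset.sum_congr rfl fun j _ => ?_
    rw [Finset.sum_comm]
    refine Finset.sum_congr rfl fun i _ => ?_
    rw [Finset.sum_comm]
    refine Finset.sum_congr rfl fun l _ => Finset.sum_congr rfl fun k _ => ?_
    rw [hh.apply i k, hh.apply j l]
    ring
  rw [← h1, ← h2]
  simp only [mul_sub, Finset.sum_sub_distrib]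

/-- Simultaneous reduction of a positive definite `g` to the identity and of a symmetric `h` to a
symmetric matrix `A` similar to `g⁻¹ * h`. -/
lemma Matrix.PosDef.exists_isSymm_trace_eq [DecidableEq ι] {g h : Matrix ι ι ℝ} (hg : g.PosDef)
    (hh : h.IsSymm) :
    ∃ A : Matrix ι ι ℝ, A.IsSymm ∧ (g⁻¹ * h).trace = A.trace ∧
      ((g⁻¹ * h) * (g⁻¹ * h)).trace = (A * A).trace ∧
      ∀ a b : ℝ, (a • g + b • h).PosSemidef → (a • (1 : Matrix ι ι ℝ) + b • A).PosSemidef := by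
  obtain ⟨B, hB⟩ := hg.inv.posSemidef.exists_eq_transpose_mul_self
  have hdet : IsUnit g.det := (Matrix.isUnit_iff_isUnit_det g).1 hg.isUnit
  have h1 : Bᵀ * (B * g) = 1 := by
    rw [← Matrix.mul_assoc, ← hB, Matrix.nonsing_inv_mul g hdet]
  have h2 : B * g * Bᵀ = 1 := mul_eq_one_comm.1 h1
  refine ⟨B * h * Bᵀ, ?_, ?_, ?_, fun a b hab => ?_⟩
  · simp [Matrix.IsSymm, hh.eq, Matrix.mul_assoc]
  · rw [hB, Matrix.mul_assoc, Matrix.trace_mul_comm]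
  · rw [hB, Matrix.mul_assoc, Matrix.mul_assoc, Matrix.trace_mul_comm]
    simp only [Matrix.mul_assoc]
  · have := hab.mul_mul_conjTranspose_same B
    rw [Matrix.conjTranspose_eq_transpose_of_trivial] at this
    have e : B * (a • g + b • h) * Bᵀ = a • (1 : Matrix ι ι ℝ) + b • (B * h * Bᵀ) := by
      rw [← h2]
      simp [Matrix.mul_add, Matrix.add_mul]
    rwa [e] at this

end Matrices

/-! ### Second derivatives at a local maximum -/

/-- Second-order necessary condition for a local maximum: along a line on which the second
derivative were positive, the point would also be a local minimum. -/
lemma IsLocalMax.hasFDerivAt_hasFDerivAt_nonpos {E : Type*} [NormedAddCommGroup E]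
    [NormedSpace ℝ E] {φ : E → ℝ} {φ' : E → E →L[ℝ] ℝ} {φ'' : E →L[ℝ] E →L[ℝ] ℝ} {p : E}
    (hmax : IsLocalMax φ p) (h1 : ∀ᶠ y in nhds p, HasFDerivAt φ (φ' y) y)
    (h2 : HasFDerivAt φ' φ'' p) (v : E) : φ'' v v ≤ 0 := by
  by_contra! hpos
  have hl : ∀ t : ℝ, HasDerivAt (fun t : ℝ => p + t • v) v t := fun t => by
    simpa using ((hasDerivAt_id t).smul_const v).const_add p
  have hc : Filter.Tendsto (fun t : ℝ => p + t • v) (nhds 0) (nhds p) := by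
    simpa using (hl 0).continuousAt.tendsto
  set ψ : ℝ → ℝ := fun t => φ (p + t • v) with hψ
  have hd : deriv ψ =ᶠ[nhds 0] fun t => φ' (p + t • v) v := by
    filter_upwards [hc.eventually h1] with t ht
    exact (ht.comp_hasDerivAt t (hl t)).deriv
  have hdd : deriv (deriv ψ) 0 = φ'' v v := by
    rw [hd.deriv_eq]
    have h2' : HasFDerivAt φ' φ'' (p + (0 : ℝ) • v) := by simpa using h2
    have h3 : HasDerivAt (fun t : ℝ => φ' (p + t • v)) (φ'' v) 0 :=
      HasFDerivAt.comp_hasDerivAt (f := fun t : ℝ => p + t • v) (0 : ℝ) h2' (hl 0)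
    have h4 := h3.clm_apply (hasDerivAt_const (0 : ℝ) v)
    simpa using h4.deriv
  have hm : IsLocalMax ψ 0 := by
    have := hc.eventually hmax
    simpa [IsLocalMax, IsMaxFilter, hψ] using this
  have hcont : ContinuousAt ψ 0 := by
    have : HasFDerivAt φ (φ' p) (p + (0 : ℝ) • v) := by simpa using h1.self_of_nhds
    exact (HasFDerivAt.comp_hasDerivAt (f := fun t : ℝ => p + t • v) (0 : ℝ) this
      (hl 0)).continuousAt
  have hmin : IsLocalMin ψ 0 :=
    isLocalMin_of_deriv_deriv_pos (by rw [hdd]; exact hpos) hm.deriv_eq_zero hcont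
  -- Both a minimum and a maximum: `ψ` is locally constant.
  have hconst : ψ =ᶠ[nhds 0] fun _ => ψ 0 := by
    filter_upwards [hm, hmin] with t h1 h2 using le_antisymm h1 h2
  have : deriv (deriv ψ) 0 = 0 := by
    rw [hconst.deriv.deriv_eq]; simp
  linarith

namespace GraphGeometry

variable {n : ℕ} {f : Base n → ℝ} {s : Set (Base n)} {x : Base n}

/-! ### The shape operator -/

lemma hMatrix_dotProduct (f : Base n → ℝ) (s : Set (Base n)) (x : Base n) (v : Fin n → ℝ) :
    v ⬝ᵥ (hMatrix f s x *ᵥ v) = secondForm f s x (WithLp.toLp 2 v) (WithLp.toLp 2 v) := by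
  have hv : (WithLp.toLp 2 v : Base n) = ∑ i, v i • EuclideanSpace.single i (1 : ℝ) := by
    ext j; simp [Finset.sum_apply, Pi.single_apply]
  rw [hv]
  simp only [secondForm, map_sum, map_smul, _root_.sum_apply, sum_inner,
    _root_.smul_apply, inner_smul_left, dotProduct, Matrix.mulVec, Finset.mul_sum,
    hMatrix, Matrix.of_apply]
  rw [Finset.sum_comm]
  refine Finset.sum_congr rfl fun i _ => Finset.sum_congr rfl fun j _ => ?_
  simp
  ring

lemma gMatrix_dotProduct (f : Base n → ℝ) (s : Set (Base n)) (x : Base n) (v : Fin n → ℝ) :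
    v ⬝ᵥ (gMatrix f s x *ᵥ v) = firstForm f s x (WithLp.toLp 2 v) (WithLp.toLp 2 v) := by
  have hv : (WithLp.toLp 2 v : Base n) = ∑ i, v i • EuclideanSpace.single i (1 : ℝ) := by
    ext j; simp [Finset.sum_apply, Pi.single_apply]
  rw [hv]
  simp only [firstForm, map_sum, map_smul, sum_inner, inner_sum,
    inner_smul_left, inner_smul_right, dotProduct, Matrix.mulVec, Finset.mul_sum,
    gMatrix, Matrix.of_apply]
  rw [Finset.sum_comm]
  refine Finset.sum_congr rfl fun i _ => Finset.sum_congr rfl fun j _ => ?_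
  simp
  ring

lemma gMatrix_isSymm (f : Base n → ℝ) (s : Set (Base n)) (x : Base n) :
    (gMatrix f s x).IsSymm := by
  ext i j
  simp [gMatrix, firstForm, real_inner_comm]

lemma gMatrix_posDef (hs : UniqueDiffOn ℝ s) (hf : ContDiffOn ℝ 2 f s) (hx : x ∈ s) :
    (gMatrix f s x).PosDef := by
  refine Matrix.PosDef.of_dotProduct_mulVec_pos ?_ fun v hv => ?_
  · rw [Matrix.IsHermitian, Matrix.conjTranspose_eq_transpose_of_trivial]
    exact gMatrix_isSymm f s x
  · rw [star_trivial, gMatrix_dotProduct, firstForm_eq hs hf hx]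
    have : 0 < inner ℝ (WithLp.toLp 2 v : Base n) (WithLp.toLp 2 v) :=
      real_inner_self_pos.2 (by simpa using hv)
    nlinarith [mul_self_nonneg (fderivWithin ℝ f s x (WithLp.toLp 2 v))]

lemma hMatrix_isSymm (hs : UniqueDiffOn ℝ s) (hc : s ⊆ closure (interior s))
    (hf : ContDiffOn ℝ 2 f s) (hx : x ∈ s) : (hMatrix f s x).IsSymm := by
  have hsymm : IsSymmSndFDerivWithinAt ℝ f s x :=
    (hf x hx).isSymmSndFDerivWithinAt (by simp) hs (hc hx) hx
  ext i j
  simp only [hMatrix, Matrix.transpose_apply, Matrix.of_apply, secondForm_eq hs hf hx]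
  rw [hsymm.eq]

/-- A symmetric matrix `A` representing the shape operator in an orthonormal frame. Its last
property transfers bounds on the second fundamental form in terms of the metric to bounds on `A`. -/
lemma exists_shape (hs : UniqueDiffOn ℝ s) (hc : s ⊆ closure (interior s))
    (hf : ContDiffOn ℝ 2 f s) (hx : x ∈ s) :
    ∃ A : Matrix (Fin n) (Fin n) ℝ, A.IsSymm ∧ meanCurvature f s x = A.trace / n ∧
      scalarCurvature f s x = (A.trace ^ 2 - (A * A).trace) / ((n : ℝ) * ((n : ℝ) - 1)) ∧
      ∀ a b : ℝ, (∀ v, 0 ≤ a * firstForm f s x v v + b * secondForm f s x v v) →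
        (a • (1 : Matrix (Fin n) (Fin n) ℝ) + b • A).PosSemidef := by
  have hh := hMatrix_isSymm hs hc hf hx
  obtain ⟨A, hA, h1, h2, h3⟩ := (gMatrix_posDef hs hf hx).exists_isSymm_trace_eq hh
  refine ⟨A, hA, ?_, ?_, fun a b hab => h3 a b ?_⟩
  · rw [meanCurvature, shapeMatrix, h1]
  · rw [← h1, ← h2, ← hh.sum_contraction_eq]
    rfl
  · refine Matrix.PosSemidef.of_dotProduct_mulVec_nonneg ?_ fun v => ?_
    · rw [Matrix.IsHermitian, Matrix.conjTranspose_eq_transpose_of_trivial]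
      simp [hh.eq, (gMatrix_isSymm f s x).eq]
    · have := hab (WithLp.toLp 2 v)
      rw [← gMatrix_dotProduct, ← hMatrix_dotProduct] at this
      simpa [Matrix.add_mulVec, Matrix.smul_mulVec, dotProduct_add] using this

/-! ### Inequalities between the curvatures -/

section CurvatureInequalities

variable (hn : 2 ≤ n) (hs : UniqueDiffOn ℝ s) (hc : s ⊆ closure (interior s))
  (hf : ContDiffOn ℝ 2 f s) (hx : x ∈ s)
include hn hs hc hf hx

lemma scalarCurvature_le_sq_meanCurvature :
    scalarCurvature f s x ≤ meanCurvature f s x ^ 2 := by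
  obtain ⟨A, hA, h1, h2, -⟩ := exists_shape hs hc hf hx
  have hn' : (2 : ℝ) ≤ n := by exact_mod_cast hn
  have h3 := hA.sq_trace_le
  rw [Fintype.card_fin] at h3
  rw [h1, h2, div_pow, div_le_div_iff₀ (by nlinarith) (by positivity)]
  nlinarith

/-- If the principal curvatures are at most `k`, then `∑ (k - kᵢ) (k - kⱼ) ≥ 0`, which bounds
the scalar curvature from below. -/
lemma le_scalarCurvature_of_secondForm_le {k : ℝ}
    (h : ∀ v, secondForm f s x v v ≤ k * firstForm f s x v v) :
    2 * k * meanCurvature f s x - k ^ 2 ≤ scalarCurvature f s x := by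
  obtain ⟨A, hA, h1, h2, h3⟩ := exists_shape hs hc hf hx
  have hn' : (2 : ℝ) ≤ n := by exact_mod_cast hn
  have h4 := (h3 k (-1) fun v => by linarith [h v]).trace_mul_self_le
  have e1 : (k • (1 : Matrix (Fin n) (Fin n) ℝ) + (-1 : ℝ) • A).trace = k * n - A.trace := by
    simp [Matrix.trace_add, Matrix.trace_smul]; ring
  have e2 : ((k • (1 : Matrix (Fin n) (Fin n) ℝ) + (-1 : ℝ) • A) *
      (k • (1 : Matrix (Fin n) (Fin n) ℝ) + (-1 : ℝ) • A)).trace =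
      k ^ 2 * n - 2 * k * A.trace + (A * A).trace := by
    simp [Matrix.trace_add, Matrix.add_mul, Matrix.mul_add, Matrix.trace_smul]; ring
  rw [e1, e2] at h4
  rw [h1, h2, le_div_iff₀ (by nlinarith)]
  have : (2 * k * (A.trace / n) - k ^ 2) * (n * (n - 1)) =
      2 * k * A.trace * (n - 1) - k ^ 2 * (n * (n - 1)) := by field_simp
  rw [this]
  nlinarith

lemma meanCurvature_le_of_secondForm_le {k : ℝ}
    (h : ∀ v, secondForm f s x v v ≤ k * firstForm f s x v v) :
    meanCurvature f s x ≤ k := by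
  obtain ⟨A, hA, h1, h2, h3⟩ := exists_shape hs hc hf hx
  have hn' : (2 : ℝ) ≤ n := by exact_mod_cast hn
  have h4 := (h3 k (-1) fun v => by linarith [h v]).trace_nonneg
  have e1 : (k • (1 : Matrix (Fin n) (Fin n) ℝ) + (-1 : ℝ) • A).trace = k * n - A.trace := by
    simp [Matrix.trace_add, Matrix.trace_smul]; ring
  rw [e1] at h4
  rw [h1, div_le_iff₀ (by linarith)]
  linarith

lemma le_meanCurvature_of_le_secondForm {k : ℝ}
    (h : ∀ v, k * firstForm f s x v v ≤ secondForm f s x v v) :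
    k ≤ meanCurvature f s x := by
  obtain ⟨A, hA, h1, h2, h3⟩ := exists_shape hs hc hf hx
  have hn' : (2 : ℝ) ≤ n := by exact_mod_cast hn
  have h4 := (h3 (-k) 1 fun v => by linarith [h v]).trace_nonneg
  have e1 : ((-k) • (1 : Matrix (Fin n) (Fin n) ℝ) + (1 : ℝ) • A).trace = A.trace - k * n := by
    simp [Matrix.trace_add, Matrix.trace_smul]; ring
  rw [e1] at h4
  rw [h1, le_div_iff₀ (by linarith)]
  linarith

lemma scalarCurvature_nonneg_of_semidefinite (h : SecondFormSemidefinite f s x) :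
    0 ≤ scalarCurvature f s x := by
  obtain ⟨A, hA, h1, h2, h3⟩ := exists_shape hs hc hf hx
  have hn' : (2 : ℝ) ≤ n := by exact_mod_cast hn
  rw [h2]
  refine div_nonneg (sub_nonneg.2 ?_) (by nlinarith)
  rcases h with h | h
  · simpa using (h3 0 1 fun v => by linarith [h v]).trace_mul_self_le
  · simpa using (h3 0 (-1) fun v => by linarith [h v]).trace_mul_self_le

end CurvatureInequalities

/-! ### Reflection of a graph -/

section Neg

lemma fderivWithin_neg_of_mem (hs : UniqueDiffOn ℝ s) (hx : x ∈ s) :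
    fderivWithin ℝ (-f) s x = -fderivWithin ℝ f s x :=
  fderivWithin_neg (hs x hx)

lemma firstForm_neg (hs : UniqueDiffOn ℝ s) (hf : ContDiffOn ℝ 2 f s) (hx : x ∈ s)
    (v w : Base n) : firstForm (-f) s x v w = firstForm f s x v w := by
  rw [firstForm_eq hs hf hx, firstForm_eq hs (show ContDiffOn ℝ 2 (-f) s from hf.neg) hx,
    fderivWithin_neg_of_mem hs hx]
  simp

lemma secondForm_neg (hs : UniqueDiffOn ℝ s) (hf : ContDiffOn ℝ 2 f s) (hx : x ∈ s)
    (v w : Base n) : secondForm (-f) s x v w = -secondForm f s x v w := by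
  have h2 : fderivWithin ℝ (fderivWithin ℝ (-f) s) s x =
      -fderivWithin ℝ (fderivWithin ℝ f s) s x := by
    rw [fderivWithin_congr (f₁ := fderivWithin ℝ (-f) s) (f := -fderivWithin ℝ f s)
      (fun y hy => fderivWithin_neg_of_mem hs hy) (fderivWithin_neg_of_mem hs hx)]
    exact fderivWithin_neg (hs x hx)
  rw [secondForm_eq hs hf hx, secondForm_eq hs (show ContDiffOn ℝ 2 (-f) s from hf.neg) hx,
    fderivWithin_neg_of_mem hs hx, h2]
  simp

end Neg

/-! ### Continuity of the curvatures -/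

section Continuity

variable (hs : UniqueDiffOn ℝ s) (hf : ContDiffOn ℝ 2 f s)
include hs hf

lemma continuousOn_gMatrix : ContinuousOn (gMatrix f s) s := by
  have h1 : ContinuousOn (fderivWithin ℝ f s) s := hf.continuousOn_fderivWithin hs (by norm_num)
  have key : ContinuousOn (fun x => (Matrix.of fun i j : Fin n =>
      inner ℝ (EuclideanSpace.single i (1 : ℝ) : Base n) (EuclideanSpace.single j 1) +
        fderivWithin ℝ f s x (EuclideanSpace.single i 1) *
          fderivWithin ℝ f s x (EuclideanSpace.single j 1))) s := by
    refine continuousOn_pi.2 fun i => continuousOn_pi.2 fun j => ?_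
    simp only [Matrix.of_apply]
    fun_prop
  refine key.congr fun x hx => ?_
  ext i j
  simp only [gMatrix, Matrix.of_apply, firstForm_eq hs hf hx]

lemma continuousOn_hMatrix : ContinuousOn (hMatrix f s) s := by
  have h1 : ContinuousOn (fderivWithin ℝ f s) s := hf.continuousOn_fderivWithin hs (by norm_num)
  have h2 : ContinuousOn (fderivWithin ℝ (fderivWithin ℝ f s) s) s :=
    (hf.fderivWithin hs (m := 1) (by norm_num)).continuousOn_fderivWithin hs (by norm_num)
  have key : ContinuousOn (fun x => (Matrix.of fun i j : Fin n =>
      (Real.sqrt (1 + ‖fderivWithin ℝ f s x‖ ^ 2))⁻¹ *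
        fderivWithin ℝ (fderivWithin ℝ f s) s x (EuclideanSpace.single i 1)
          (EuclideanSpace.single j 1))) s := by
    refine continuousOn_pi.2 fun i => continuousOn_pi.2 fun j => ?_
    simp only [Matrix.of_apply]
    refine ContinuousOn.mul (ContinuousOn.inv₀ (by fun_prop) fun x _ => by positivity) (by fun_prop)
  refine key.congr fun x hx => ?_
  ext i j
  simp only [hMatrix, Matrix.of_apply, secondForm_eq hs hf hx]

lemma continuousOn_inv_gMatrix : ContinuousOn (fun x => (gMatrix f s x)⁻¹) s := by
  have hg := continuousOn_gMatrix hs hf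
  simp only [Matrix.inv_def, Ring.inverse_eq_inv']
  refine ContinuousOn.smul
    (ContinuousOn.inv₀ ?_ fun x hx => (gMatrix_posDef hs hf hx).det_pos.ne') ?_
  · exact (continuous_id.matrix_det).comp_continuousOn hg
  · exact (continuous_id.matrix_adjugate).comp_continuousOn hg

lemma continuousOn_meanCurvature : ContinuousOn (meanCurvature f s) s := by
  have h1 : ContinuousOn (fun x => (gMatrix f s x)⁻¹ * hMatrix f s x) s :=
    (continuousOn_inv_gMatrix hs hf).mul (continuousOn_hMatrix hs hf)
  exact ((continuous_id.matrix_trace).comp_continuousOn h1).div_const _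

lemma continuousOn_scalarCurvature : ContinuousOn (scalarCurvature f s) s := by
  have hG : ∀ i j, ContinuousOn (fun x => (gMatrix f s x)⁻¹ i j) s := fun i j =>
    (continuous_apply_apply i j).comp_continuousOn (continuousOn_inv_gMatrix hs hf)
  have hH : ∀ i j, ContinuousOn (fun x => hMatrix f s x i j) s := fun i j =>
    (continuous_apply_apply i j).comp_continuousOn (continuousOn_hMatrix hs hf)
  unfold scalarCurvature ricciCurvature riemannCurvature
  refine ContinuousOn.div_const ?_ _
  refine continuousOn_finsetSum _ fun j _ => continuousOn_finsetSum _ fun k _ => (hG j k).mul ?_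
  refine continuousOn_finsetSum _ fun i _ => continuousOn_finsetSum _ fun l _ => (hG i l).mul ?_
  exact ((hH i l).mul (hH j k)).sub ((hH i k).mul (hH j l))

end Continuity
end GraphGeometry

namespace GraphGeometry

variable {n : ℕ}

/-! ### The comparison hemisphere -/

section Hemisphere

/-- The function whose graph is the lower hemisphere of radius `ρ` centred at `(c, 0)`. -/
noncomputable def hemisphere (c : Base n) (ρ : ℝ) (x : Base n) : ℝ :=
  -Real.sqrt (ρ ^ 2 - ‖x - c‖ ^ 2)

variable {c x : Base n} {r ρ : ℝ}

lemma sq_sub_norm_sq_pos (hx : ‖x - c‖ < ρ) : 0 < ρ ^ 2 - ‖x - c‖ ^ 2 := by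
  nlinarith [norm_nonneg (x - c)]

lemma hasFDerivAt_sqrt_sq_sub (hx : ‖x - c‖ < ρ) :
    HasFDerivAt (fun y => Real.sqrt (ρ ^ 2 - ‖y - c‖ ^ 2))
      (-((Real.sqrt (ρ ^ 2 - ‖x - c‖ ^ 2))⁻¹ • innerSL ℝ (x - c))) x := by
  have h1 : HasFDerivAt (fun y : Base n => y - c) (ContinuousLinearMap.id ℝ (Base n)) x :=
    (hasFDerivAt_id x).sub_const c
  have h2 := (h1.norm_sq.const_sub (ρ ^ 2)).sqrt (sq_sub_norm_sq_pos hx).ne'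
  convert! h2 using 1
  ext v
  have := Real.sqrt_pos.2 (sq_sub_norm_sq_pos hx)
  simp
  field_simp

lemma hasFDerivAt_hemisphere (hx : ‖x - c‖ < ρ) :
    HasFDerivAt (hemisphere c ρ)
      ((Real.sqrt (ρ ^ 2 - ‖x - c‖ ^ 2))⁻¹ • innerSL ℝ (x - c)) x := by
  have h := (hasFDerivAt_sqrt_sq_sub hx).neg
  rw [neg_neg] at h
  exact h

lemma norm_sub_lt_of_mem (hρ : r < ρ) (hx : x ∈ closedBall c r) : ‖x - c‖ < ρ :=
  (mem_closedBall_iff_norm.1 hx).trans_lt hρ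

lemma uniqueDiffOn_closedBall (c : Base n) (hr : 0 < r) : UniqueDiffOn ℝ (closedBall c r) :=
  uniqueDiffOn_convex (convex_closedBall c r)
    ⟨c, ball_subset_interior_closedBall (mem_ball_self hr)⟩

lemma closedBall_subset_closure_interior (c : Base n) (hr : 0 < r) :
    closedBall c r ⊆ closure (interior (closedBall c r)) := by
  rw [interior_closedBall c hr.ne', closure_ball c hr.ne']

lemma contDiffOn_hemisphere (hρ : r < ρ) : ContDiffOn ℝ 2 (hemisphere c ρ) (closedBall c r) := by
  refine (ContDiffOn.sqrt ?_ fun x hx =>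
    (sq_sub_norm_sq_pos (norm_sub_lt_of_mem hρ hx)).ne').neg
  exact (contDiff_const.sub ((contDiff_id.sub contDiff_const).norm_sq ℝ)).contDiffOn

lemma fderivWithin_hemisphere (hr : 0 < r) (hρ : r < ρ) (hx : x ∈ closedBall c r) :
    fderivWithin ℝ (hemisphere c ρ) (closedBall c r) x =
      (Real.sqrt (ρ ^ 2 - ‖x - c‖ ^ 2))⁻¹ • innerSL ℝ (x - c) :=
  (hasFDerivAt_hemisphere (norm_sub_lt_of_mem hρ hx)).hasFDerivWithinAt.fderivWithin
    (uniqueDiffOn_closedBall c hr x hx)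

lemma fderivWithin_fderivWithin_hemisphere (hr : 0 < r) (hρ : r < ρ) (hx : x ∈ closedBall c r)
    (v w : Base n) :
    fderivWithin ℝ (fderivWithin ℝ (hemisphere c ρ) (closedBall c r)) (closedBall c r) x v w =
      (Real.sqrt (ρ ^ 2 - ‖x - c‖ ^ 2))⁻¹ * inner ℝ v w +
        (Real.sqrt (ρ ^ 2 - ‖x - c‖ ^ 2) ^ 3)⁻¹ * (inner ℝ (x - c) v * inner ℝ (x - c) w) := by
  have hx' := norm_sub_lt_of_mem hρ hx
  have hpos := Real.sqrt_pos.2 (sq_sub_norm_sq_pos hx')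
  have h1 : HasFDerivAt (fun y : Base n => innerSL ℝ (y - c)) (innerSL ℝ : Base n →L[ℝ] _) x := by
    have h := (innerSL ℝ : Base n →L[ℝ] _).hasFDerivAt.comp x ((hasFDerivAt_id x).sub_const c)
    rw [ContinuousLinearMap.comp_id] at h
    exact h
  have h2 : HasFDerivAt (fun y : Base n => (Real.sqrt (ρ ^ 2 - ‖y - c‖ ^ 2))⁻¹)
      ((Real.sqrt (ρ ^ 2 - ‖x - c‖ ^ 2) ^ 3)⁻¹ • innerSL ℝ (x - c)) x := by
    convert! (hasDerivAt_inv hpos.ne').comp_hasFDerivAt x (hasFDerivAt_sqrt_sq_sub hx') using 1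
    ext v
    simp
    field_simp
  have h3 := (h2.smul h1).hasFDerivWithinAt (s := closedBall c r)
  have h4 := h3.congr (fun y hy => fderivWithin_hemisphere hr hρ hy)
    (fderivWithin_hemisphere hr hρ hx)
  rw [h4.fderivWithin (uniqueDiffOn_closedBall c hr x hx)]
  simp only [_root_.add_apply, _root_.smul_apply, ContinuousLinearMap.smulRight_apply,
    innerSL_apply_apply, smul_eq_mul, mul_assoc]
  rfl

/-- The hemisphere is umbilic: all its principal curvatures equal `1 / ρ`. -/
lemma secondForm_hemisphere (hr : 0 < r) (hρ : r < ρ) (hx : x ∈ closedBall c r) (v w : Base n) :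
    secondForm (hemisphere c ρ) (closedBall c r) x v w =
      1 / ρ * firstForm (hemisphere c ρ) (closedBall c r) x v w := by
  have hs := uniqueDiffOn_closedBall c hr
  have hx' := norm_sub_lt_of_mem hρ hx
  have hpos := Real.sqrt_pos.2 (sq_sub_norm_sq_pos hx')
  have hsq := Real.sq_sqrt (sq_sub_norm_sq_pos hx').le
  rw [secondForm_eq hs (contDiffOn_hemisphere hρ) hx, firstForm_eq hs (contDiffOn_hemisphere hρ) hx,
    fderivWithin_fderivWithin_hemisphere hr hρ hx, fderivWithin_hemisphere hr hρ hx]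
  set σ := Real.sqrt (ρ ^ 2 - ‖x - c‖ ^ 2)
  have hρ0 : 0 < ρ := hr.trans hρ
  have hW : Real.sqrt (1 + ‖σ⁻¹ • innerSL ℝ (x - c)‖ ^ 2) = ρ / σ := by
    rw [norm_smul, innerSL_apply_norm, Real.sqrt_eq_iff_mul_self_eq (by positivity) (by positivity),
      Real.norm_of_nonneg (by positivity)]
    field_simp
    linarith
  rw [hW]
  simp only [_root_.smul_apply, innerSL_apply_apply, smul_eq_mul]
  field_simp

end Hemisphere

/-! ### Points of contact with hemispheres -/

section Tangency

variable {c : Base n} {r : ℝ} {f : Base n → ℝ}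

/-- A graph over the ball of radius `r` is touched from above by a vertical translate of a lower
hemisphere of radius `1 / k > r`: at the point of contact the principal curvatures are at
most `k`. -/
lemma exists_secondForm_le (hr : 0 < r) (hf : ContDiffOn ℝ 2 f (closedBall c r)) :
    ∃ k, 0 < k ∧ k < 1 / r ∧ ∃ p ∈ closedBall c r,
      ∀ v, secondForm f (closedBall c r) p v v ≤ k * firstForm f (closedBall c r) p v v := by
  have hs := uniqueDiffOn_closedBall c hr
  have hcs : IsCompact (closedBall c r) := isCompact_closedBall c r
  have hcB : c ∈ closedBall c r := mem_closedBall_self hr.le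
  obtain ⟨K, hK⟩ := hcs.exists_bound_of_continuousOn
    (hf.continuousOn_fderivWithin hs (by norm_num))
  have hK0 : 0 ≤ K := (norm_nonneg _).trans (hK c hcB)
  -- The slope of the hemisphere over the boundary sphere is `r / σ = K + 1`, steeper than `f`.
  set σ := r / (K + 1) with hσ
  have hσ0 : 0 < σ := by positivity
  set ρ := Real.sqrt (r ^ 2 + σ ^ 2)
  have hρsq : ρ ^ 2 = r ^ 2 + σ ^ 2 := Real.sq_sqrt (by positivity)
  have hρ : r < ρ := Real.lt_sqrt_of_sq_lt (by nlinarith)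
  have hρ0 : 0 < ρ := hr.trans hρ
  have hu : ContDiffOn ℝ 2 (hemisphere c ρ) (closedBall c r) := contDiffOn_hemisphere hρ
  refine ⟨1 / ρ, by positivity, one_div_lt_one_div_of_lt hr hρ, ?_⟩
  obtain ⟨p, hp, hmax⟩ := hcs.exists_isMaxOn ⟨c, hcB⟩ (hf.continuousOn.sub hu.continuousOn)
  have hd : ∀ y ∈ closedBall c r, HasFDerivWithinAt (f - hemisphere c ρ)
      (fderivWithin ℝ f (closedBall c r) y -
        fderivWithin ℝ (hemisphere c ρ) (closedBall c r) y) (closedBall c r) y := fun y hy =>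
    (hf.differentiableOn (by norm_num) y hy).hasFDerivWithinAt.sub
      (hu.differentiableOn (by norm_num) y hy).hasFDerivWithinAt
  have hint : ‖p - c‖ < r := by
    refine lt_of_le_of_ne (mem_closedBall_iff_norm.1 hp) fun hpr => ?_
    have hcone : c - p ∈ posTangentConeAt (closedBall c r) p :=
      sub_mem_posTangentConeAt_of_segment_subset ((convex_closedBall c r).segment_subset hp hcB)
    have h1 := IsLocalMaxOn.hasFDerivWithinAt_nonpos hmax.localize (hd p hp) hcone
    have h2 : fderivWithin ℝ (hemisphere c ρ) (closedBall c r) p (c - p) = -(r * (K + 1)) := by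
      have e1 : ρ ^ 2 - ‖p - c‖ ^ 2 = σ ^ 2 := by rw [hpr, hρsq]; ring
      have e2 : inner ℝ (p - c) (c - p) = -r ^ 2 := by
        rw [← neg_sub p c, inner_neg_right, real_inner_self_eq_norm_sq, hpr]
      rw [fderivWithin_hemisphere hr hρ hp, e1, Real.sqrt_sq hσ0.le]
      simp only [_root_.smul_apply, innerSL_apply_apply, e2, smul_eq_mul, hσ]
      field_simp
    have h3 : |fderivWithin ℝ f (closedBall c r) p (c - p)| ≤ K * r := by
      have := (fderivWithin ℝ f (closedBall c r) p).le_of_opNorm_le (hK p hp) (c - p)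
      rwa [Real.norm_eq_abs, norm_sub_rev, hpr] at this
    rw [_root_.sub_apply, h2] at h1
    nlinarith [(abs_le.1 h3).1]
  have hnear : ∀ᶠ y in nhds p, closedBall c r ∈ nhds y := by
    filter_upwards [isOpen_ball.mem_nhds (mem_ball_iff_norm.2 hint)] with y hy
    exact Filter.mem_of_superset (isOpen_ball.mem_nhds hy) ball_subset_closedBall
  have hlm : IsLocalMax (f - hemisphere c ρ) p := hmax.isLocalMax hnear.self_of_nhds
  have hDeq : fderivWithin ℝ f (closedBall c r) p =
      fderivWithin ℝ (hemisphere c ρ) (closedBall c r) p :=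
    sub_eq_zero.1 (hlm.hasFDerivAt_eq_zero ((hd p hp).hasFDerivAt hnear.self_of_nhds))
  refine ⟨p, hp, fun v => ?_⟩
  have hD2 := hlm.hasFDerivAt_hasFDerivAt_nonpos
    (hnear.mono fun y hy => (hd y (mem_of_mem_nhds hy)).hasFDerivAt hy)
    (((hasFDerivWithinAt_fderivWithin hs hf hp).sub
      (hasFDerivWithinAt_fderivWithin hs hu hp)).hasFDerivAt hnear.self_of_nhds) v
  have hfirst : firstForm f (closedBall c r) p v v =
      firstForm (hemisphere c ρ) (closedBall c r) p v v := by
    rw [firstForm_eq hs hf hp, firstForm_eq hs hu hp, hDeq]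
  rw [hfirst, ← secondForm_hemisphere hr hρ hp, secondForm_eq hs hf hp, secondForm_eq hs hu hp,
    hDeq]
  refine mul_le_mul_of_nonneg_left ?_ (by positivity)
  simpa using hD2

/-- A graph over the ball of radius `r` is touched from below by an upper hemisphere of radius
`1 / k > r`: at the point of contact the principal curvatures are at least `-k`. -/
lemma exists_le_secondForm (hr : 0 < r) (hf : ContDiffOn ℝ 2 f (closedBall c r)) :
    ∃ k, 0 < k ∧ k < 1 / r ∧ ∃ p ∈ closedBall c r,
      ∀ v, -k * firstForm f (closedBall c r) p v v ≤ secondForm f (closedBall c r) p v v := by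
  have hs := uniqueDiffOn_closedBall c hr
  obtain ⟨k, hk, hkr, p, hp, h⟩ :=
    exists_secondForm_le (f := -f) hr (show ContDiffOn ℝ 2 (-f) (closedBall c r) from hf.neg)
  refine ⟨k, hk, hkr, p, hp, fun v => ?_⟩
  have := h v
  rw [firstForm_neg hs hf hp, secondForm_neg hs hf hp] at this
  linarith

lemma isPreconnected_closedBall (c : Base n) (r : ℝ) : IsPreconnected (closedBall c r) :=
  (convex_closedBall c r).isPreconnected

/-- If the scalar curvature is positive, then it is smaller than `1 / r ^ 2` somewhere: the mean
curvature has no zero, hence a constant sign, and a hemisphere touching the graph on the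
appropriate side bounds it by `1 / r`. -/
lemma exists_scalarCurvature_lt (hn : 2 ≤ n) (hr : 0 < r)
    (hf : ContDiffOn ℝ 2 f (closedBall c r))
    (hpos : ∀ x ∈ closedBall c r, 0 < scalarCurvature f (closedBall c r) x) :
    ∃ p ∈ closedBall c r, scalarCurvature f (closedBall c r) p < 1 / r ^ 2 := by
  have hs := uniqueDiffOn_closedBall c hr
  have hc := closedBall_subset_closure_interior c hr
  have hH : ContinuousOn (meanCurvature f (closedBall c r)) (closedBall c r) :=
    continuousOn_meanCurvature hs hf
  have hle : ∀ x ∈ closedBall c r, scalarCurvature f (closedBall c r) x ≤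
      meanCurvature f (closedBall c r) x ^ 2 := fun x hx =>
    scalarCurvature_le_sq_meanCurvature hn hs hc hf hx
  have hne : ∀ x ∈ closedBall c r, meanCurvature f (closedBall c r) x ≠ 0 := fun x hx h0 => by
    have := (hpos x hx).trans_le (hle x hx)
    simp [h0] at this
  obtain ⟨k, hk, hkr, p, hp, h⟩ := exists_secondForm_le hr hf
  obtain ⟨l, hl, hlr, q, hq, h'⟩ := exists_le_secondForm hr hf
  have hp1 : meanCurvature f (closedBall c r) p ≤ k :=
    meanCurvature_le_of_secondForm_le hn hs hc hf hp h
  have hq1 : -l ≤ meanCurvature f (closedBall c r) q :=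
    le_meanCurvature_of_le_secondForm hn hs hc hf hq h'
  have hfin : ∀ x ∈ closedBall c r, ∀ m : ℝ, |meanCurvature f (closedBall c r) x| ≤ m → m < 1 / r →
      scalarCurvature f (closedBall c r) x < 1 / r ^ 2 := fun x hx m hm hmr => by
    refine (hle x hx).trans_lt ?_
    rw [← sq_abs, ← one_div_pow]
    exact pow_lt_pow_left₀ (hm.trans_lt hmr) (abs_nonneg _) two_ne_zero
  by_cases h0 : 0 ≤ meanCurvature f (closedBall c r) p
  · exact ⟨p, hp, hfin p hp k (by rwa [abs_of_nonneg h0]) hkr⟩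
  · refine ⟨q, hq, hfin q hq l ?_ hlr⟩
    have hq0 : meanCurvature f (closedBall c r) q < 0 := by
      by_contra! hq0
      obtain ⟨y, hy, hy0⟩ := (isPreconnected_closedBall c r).intermediate_value hp hq hH
        (show (0 : ℝ) ∈ Icc _ _ from ⟨(not_le.1 h0).le, hq0⟩)
      exact hne y hy hy0
    rw [abs_of_neg hq0]
    linarith

end Tangency
end GraphGeometry

/-! ### Curvature estimates -/

theorem mainTheorem1 (n : ℕ) (hn : 2 ≤ n) (c : EuclideanSpace ℝ (Fin n)) (r : ℝ) (hr : 0 < r) :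
    -- the two estimates
    (∀ f : EuclideanSpace ℝ (Fin n) → ℝ, ContDiffOn ℝ 2 f (closedBall c r) →
      (BddAbove (range fun x : closedBall c r =>
          |GraphGeometry.meanCurvature f (closedBall c r) x|) ∧
        (⨅ x : closedBall c r, |GraphGeometry.scalarCurvature f (closedBall c r) x|) ≤
          ((⨆ x : closedBall c r, |GraphGeometry.meanCurvature f (closedBall c r) x|) + 1 / r)
            * (2 / r)) ∧
      ((∃ q ∈ closedBall c r, GraphGeometry.SecondFormSemidefinite f (closedBall c r) q) →
        (⨅ x : closedBall c r, |GraphGeometry.scalarCurvature f (closedBall c r) x|)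
          < 1 / r ^ 2)) ∧
    -- sharpness of the second estimate
    (∀ C : ℝ, C < 1 / r ^ 2 →
      ∃ f : EuclideanSpace ℝ (Fin n) → ℝ, ContDiffOn ℝ 2 f (closedBall c r) ∧
        (∃ q ∈ closedBall c r, GraphGeometry.SecondFormSemidefinite f (closedBall c r) q) ∧
        C < ⨅ x : closedBall c r, |GraphGeometry.scalarCurvature f (closedBall c r) x|) := by
  have hs := GraphGeometry.uniqueDiffOn_closedBall c hr
  have hc := GraphGeometry.closedBall_subset_closure_interior c hr
  have hcB : c ∈ closedBall c r := mem_closedBall_self hr.le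
  have : Nonempty (closedBall c r) := ⟨⟨c, hcB⟩⟩
  refine ⟨fun f hf => ?_, fun C hC => ?_⟩
  · set H := GraphGeometry.meanCurvature f (closedBall c r)
    set R := GraphGeometry.scalarCurvature f (closedBall c r)
    have hHc : ContinuousOn H (closedBall c r) := GraphGeometry.continuousOn_meanCurvature hs hf
    have hRc : ContinuousOn R (closedBall c r) := GraphGeometry.continuousOn_scalarCurvature hs hf
    have hbdd : BddAbove (range fun x : closedBall c r => |H x|) := by
      have := (isCompact_closedBall c r).bddAbove_image hHc.abs
      rwa [image_eq_range] at this
    have hinf : ∀ x ∈ closedBall c r, (⨅ x : closedBall c r, |R x|) ≤ |R x| := fun x hx =>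
      ciInf_le ⟨0, by rintro _ ⟨y, rfl⟩; exact abs_nonneg _⟩ (⟨x, hx⟩ : closedBall c r)
    have hsup : ∀ x ∈ closedBall c r, |H x| ≤ ⨆ x : closedBall c r, |H x| := fun x hx =>
      le_ciSup hbdd (⟨x, hx⟩ : closedBall c r)
    have hr2 : 0 < 1 / r ^ 2 := by positivity
    -- A point where `R` is nonnegative already gives the sharp bound.
    have hlt : ∀ q ∈ closedBall c r, 0 ≤ R q → (⨅ x : closedBall c r, |R x|) < 1 / r ^ 2 := by
      intro q hq hRq
      by_cases hzero : ∃ y ∈ closedBall c r, R y = 0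
      · obtain ⟨y, hy, hy0⟩ := hzero
        refine (hinf y hy).trans_lt ?_
        rwa [hy0, abs_zero]
      · push Not at hzero
        have hpos : ∀ x ∈ closedBall c r, 0 < R x := fun x hx => by
          by_contra! hx0
          obtain ⟨y, hy, hy0⟩ := (GraphGeometry.isPreconnected_closedBall c r).intermediate_value
            hx hq hRc (show (0 : ℝ) ∈ Icc _ _ from ⟨hx0, hRq⟩)
          exact hzero y hy hy0
        obtain ⟨p, hp, hlt⟩ := GraphGeometry.exists_scalarCurvature_lt hn hr hf hpos
        refine (hinf p hp).trans_lt ?_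
        rwa [abs_of_pos (hpos p hp)]
    refine ⟨⟨hbdd, ?_⟩, fun ⟨q, hq, hsd⟩ => hlt q hq
      (GraphGeometry.scalarCurvature_nonneg_of_semidefinite hn hs hc hf hq hsd)⟩
    obtain ⟨k, hk, hkr, p, hp, hle⟩ := GraphGeometry.exists_secondForm_le hr hf
    have hS0 : 0 ≤ ⨆ x : closedBall c r, |H x| := (abs_nonneg _).trans (hsup p hp)
    have hr1 : 0 < 1 / r := by positivity
    have e : ((⨆ x : closedBall c r, |H x|) + 1 / r) * (2 / r) =
        2 * (⨆ x : closedBall c r, |H x|) * (1 / r) + 2 * (1 / r) ^ 2 := by ring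
    rw [e]
    by_cases hRp : 0 ≤ R p
    · have h1 := hlt p hp hRp
      rw [← one_div_pow] at h1
      nlinarith [mul_nonneg hS0 hr1.le]
    · -- Here `-R p ≤ k ^ 2 - 2 * k * H p` with `k < 1 / r`.
      refine (hinf p hp).trans ?_
      have h1 : 2 * k * H p - k ^ 2 ≤ R p :=
        GraphGeometry.le_scalarCurvature_of_secondForm_le hn hs hc hf hp hle
      rw [abs_of_neg (not_le.1 hRp)]
      have h2 : -H p ≤ ⨆ x : closedBall c r, |H x| := (neg_le_abs _).trans (hsup p hp)
      have h3 := mul_le_mul_of_nonneg_left h2 hk.le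
      have h4 := mul_le_mul_of_nonneg_left hkr.le hS0
      nlinarith
  · -- A hemisphere of radius `ρ > r` close to `r`, chosen so that `1 / ρ ^ 2 > C`.
    obtain ⟨ρ, hρC, hρ⟩ : ∃ ρ, C < 1 / ρ ^ 2 ∧ r < ρ := by
      have hcont : ContinuousAt (fun ρ : ℝ => 1 / ρ ^ 2) r :=
        ContinuousAt.div continuousAt_const (by fun_prop) (by positivity)
      have h1 : ∀ᶠ ρ in nhdsWithin r (Ioi r), C < 1 / ρ ^ 2 :=
        nhdsWithin_le_nhds (hcont.eventually (lt_mem_nhds hC))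
      exact (h1.and self_mem_nhdsWithin).exists
    have hρ0 : 0 < ρ := hr.trans hρ
    have hu : ContDiffOn ℝ 2 (GraphGeometry.hemisphere c ρ) (closedBall c r) :=
      GraphGeometry.contDiffOn_hemisphere hρ
    refine ⟨GraphGeometry.hemisphere c ρ, hu, ⟨c, hcB, Or.inl fun v => ?_⟩, ?_⟩
    · rw [GraphGeometry.secondForm_hemisphere hr hρ hcB]
      exact mul_nonneg (by positivity) real_inner_self_nonneg
    · refine hρC.trans_le (le_ciInf fun x => ?_)
      have h1 := GraphGeometry.le_scalarCurvature_of_secondForm_le hn hs hc hu x.2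
        fun v => (GraphGeometry.secondForm_hemisphere hr hρ x.2 v v).le
      have h2 := GraphGeometry.le_meanCurvature_of_le_secondForm hn hs hc hu x.2
        fun v => (GraphGeometry.secondForm_hemisphere hr hρ x.2 v v).ge
      refine le_trans ?_ (le_abs_self _)
      have hρ1 : 0 < 1 / ρ := by positivity
      rw [← one_div_pow]
      nlinarith
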